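/- All algebras are associative unital $\mathbb C$-algebras, and complete locally convex spaces are Hausdorff. An *Arens–Michael algebra* is an algebra with a complete Hausdorff topology defined by a family of submultiplicative seminorms. An *Arens–Michael envelope* of an algebra $A$ is an Arens–Michael algebra $\widehat A$ with a homomorphism $i_A:A\to\widehat A$ such that every homomorphism $f:A\to B$ to an Arens–Michael algebra satisfies $f=g\circ i_A$ for a unique continuous homomorphism $g:\widehat A\to B$. For an automorphism $\alpha$ of an algebra $A$, let $A_\alpha$ be the $A$-bimodule that equals $A$ as a left module, with right action $x\circ a=x\,\alpha(a)$. The bimodules $A_\alpha$ and $A_{\alpha^{-1}}$ are inverse to each other via the maps $i_1:A_\alpha\otimes_A A_{\alpha^{-1}}\to A$, $i_1(x\otimes y)=x\,\alpha(y)$, and $i_2:A_{\alpha^{-1}}\otimes_A A_\alpha\to A$, $i_2(y\otimes x)=y\,\alpha^{-1}(x)$. The Laurent tensor algebra is $L_A(A_\alpha)=\bigoplus_{n\in\mathbb Z}(A_\alpha)^{\otimes_A n}$, where $(A_\alpha)^{\otimes 0}=A$ and $(A_\alpha)^{\otimes -n}=(A_{\alpha^{-1}})^{\otimes_A n}$,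 with multiplication given by concatenation of tensors and by $x\cdot y=i_1(x\otimes y)$, $y\cdot x=i_2(y\otimes x)$ for $x\in A_\alpha$, $y\in A_{\alpha^{-1}}$. The Laurent Ore extension $A[t,t^{-1};\alpha]$ consists of the finite sums $\sum_{i\in\mathbb Z}a_it^i$ with $a_i\in A$, multiplied by the rule $ta=\alpha(a)t$. If $A$ is an Arens–Michael algebra and $\alpha$ is a topological automorphism of it, then $A_\alpha$ and $A_{\alpha^{-1}}$ are topologically inverse via the same formulas (with $\hat\otimes_A$, the complete projective tensor product over $A$, in place of $\otimes_A$). The *analytic Laurent tensor algebra* $\widehat L_A(A_\alpha)$ is an Arens–Michael algebra with a continuous homomorphism $\theta:A\to\widehat L_A(A_\alpha)$ and continuous $A$-bimodule homomorphisms $\varphi:A_\alpha\to\widehat L_A(A_\alpha)$, $\psi:A_{\alpha^{-1}}\to\widehat L_A(A_\alpha)$ satisfying $\varphi(x)\psi(y)=\theta(i_1(x\otimes y))$ and $\psi(y)\varphi(x)=\theta(i_2(y\otimes x))$, such that for every Arens–Michael algebra $B$ and every triple $(\theta',\varphi',\psi')$ of the same kind with values in $B$ there is a unique continuous homomorphism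 $f:\widehat L_A(A_\alpha)\to B$ with $f\theta=\theta'$, $f\varphi=\varphi'$, $f\psi=\psi'$. **Corollary 2.1.** Let $A$ be an algebra whose Arens–Michael envelope $(\widehat A,i_A)$ is a Fréchet algebra (that is, $\widehat A$ is metrizable), let $\alpha$ be an automorphism of $A$, and let $\widehat\alpha$ be the induced topological automorphism of $\widehat A$, so that $\widehat\alpha\circ i_A=i_A\circ\alpha$. Then $A[t,t^{-1};\alpha]$, with the inclusions of $A$, $A_\alpha=At$ and $A_{\alpha^{-1}}=At^{-1}$, is the Laurent tensor algebra $L_A(A_\alpha)$; the analytic Laurent tensor algebra $\widehat L_{\widehat A}(\widehat A_{\widehat\alpha})$ exists; and there is an isomorphism of topological algebras $$\bigl(A[t,t^{-1};\alpha]\bigr)^{\widehat{\ }}=\widehat{L_A(A_\alpha)}\;\cong\;\widehat L_{\widehat A}(\widehat A_{\widehat\alpha}).$$ More precisely, $\widehat L_{\widehat A}(\widehat A_{\widehat\alpha})$ is an Arens–Michael envelope of $A[t,t^{-1};\alpha]$ through a homomorphism that sends $a\in A$ to $\theta(i_A(a))$, $t$ to $\varphi(1)$ and $t^{-1}$ to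 $\psi(1)$, and it is an Arens–Michael envelope of $L_A(A_\alpha)$ through a homomorphism that restricts to $\theta\circ i_A$ on $A$, to $\varphi\circ i_A$ on $A_\alpha$ and to $\psi\circ i_A$ on $A_{\alpha^{-1}}$. -/

import Mathlib

open scoped TensorProduct RightActions Topology

universe u

noncomputable section

/-! ### Complete locally convex spaces, Arens–Michael algebras, topological bimodules -/

/-- A complete (Hausdorff) locally convex space over `ℂ`. -/
class IsCompleteLCS (E : Type*) [AddCommGroup E] [Module ℂ E] [UniformSpace E] : Prop
    extends IsUniformAddGroup E, ContinuousSMul ℂ E, LocallyConvexSpace ℝ E,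
      CompleteSpace E, T2Space E

/-- An Arens–Michael algebra: a unital associative `ℂ`-algebra with a complete Hausdorff
topology which is defined by a family of submultiplicative seminorms. -/
class IsArensMichaelAlgebra (B : Type*) [Ring B] [Algebra ℂ B] [UniformSpace B] : Prop
    extends IsUniformAddGroup B, CompleteSpace B, T2Space B where
  exists_seminorms : ∃ P : Set (Seminorm ℂ B),
    (∀ p ∈ P, ∀ x y : B, p (x * y) ≤ p x * p y) ∧ WithSeminorms (fun p : P => (p : Seminorm ℂ B))

/-- The laws of an `A`-bimodule over a `ℂ`-algebra `A` for a left and a right action of `A`. Here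
and below `a • m` is the left action and `m <• a` the right one. -/
class IsBimodule (A M : Type*) [Ring A] [Algebra ℂ A]
    [AddCommGroup M] [Module ℂ M] [Module A M] [Module Aᵐᵒᵖ M] : Prop
    extends SMulCommClass A Aᵐᵒᵖ M, IsScalarTower ℂ A M where
  op_smul_assoc : ∀ (c : ℂ) (a : A) (m : M), m <• (c • a) = c • (m <• a)

/-- `M` is an `A`-`⊗̂`-bimodule: a complete locally convex space with an algebraic bimodule
structure such that both actions `A × M → M` and `M × A → M` are jointly continuous. -/
class IsTopBimodule (A M : Type*) [Ring A] [Algebra ℂ A] [TopologicalSpace A]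
    [AddCommGroup M] [Module ℂ M] [Module A M] [Module Aᵐᵒᵖ M] [UniformSpace M] : Prop
    extends IsBimodule A M, IsCompleteLCS M where
  continuous_left : Continuous fun q : A × M => q.1 • q.2
  continuous_right : Continuous fun q : M × A => q.1 <• q.2

/-! ### Arens–Michael envelopes -/

/-- `(Ahat, iA)` is an Arens–Michael envelope of the algebra `A`: every homomorphism from `A` to
an Arens–Michael algebra `B` extends uniquely to a continuous homomorphism `Ahat → B`. -/
def IsArensMichaelEnvelope {A Ahat : Type u} [Ring A] [Algebra ℂ A]
    [Ring Ahat] [Algebra ℂ Ahat] [UniformSpace Ahat] [IsArensMichaelAlgebra Ahat]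
    (iA : A →ₐ[ℂ] Ahat) : Prop :=
  ∀ (B : Type u) [Ring B] [Algebra ℂ B] [UniformSpace B] [IsArensMichaelAlgebra B]
    (f : A →ₐ[ℂ] B), ∃! g : Ahat →A[ℂ] B, ∀ a, g (iA a) = f a

namespace IsArensMichaelEnvelope

variable {A Ahat : Type u} [Ring A] [Algebra ℂ A]
  [Ring Ahat] [Algebra ℂ Ahat] [UniformSpace Ahat] [IsArensMichaelAlgebra Ahat]
  {iA : A →ₐ[ℂ] Ahat}

/-- The continuous endomorphism of `Ahat` induced by an endomorphism of `A`. -/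
def map (h : IsArensMichaelEnvelope iA) (f : A →ₐ[ℂ] A) : Ahat →A[ℂ] Ahat :=
  (h Ahat (iA.comp f)).choose

theorem map_apply (h : IsArensMichaelEnvelope iA) (f : A →ₐ[ℂ] A) (a : A) :
    h.map f (iA a) = iA (f a) :=
  (h Ahat (iA.comp f)).choose_spec.1 a

theorem hom_ext (h : IsArensMichaelEnvelope iA) {g g' : Ahat →A[ℂ] Ahat}
    (H : ∀ a, g (iA a) = g' (iA a)) : g = g' :=
  (h Ahat (g'.toAlgHom.comp iA)).unique H fun _ => rfl

/-- The topological automorphism `α̂` of `Ahat` induced by an automorphism `α` of `A`; it is the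
unique continuous endomorphism with `α̂ ∘ iA = iA ∘ α`. -/
def mapEquiv (h : IsArensMichaelEnvelope iA) (α : A ≃ₐ[ℂ] A) : Ahat ≃A[ℂ] Ahat :=
  have h₁ : (h.map α.symm).comp (h.map α) = ContinuousAlgHom.id ℂ Ahat :=
    h.hom_ext fun a => by simp [map_apply]
  have h₂ : (h.map α).comp (h.map α.symm) = ContinuousAlgHom.id ℂ Ahat :=
    h.hom_ext fun a => by simp [map_apply]
  { AlgEquiv.ofAlgHom (h.map α).toAlgHom (h.map α.symm).toAlgHom
      (AlgHom.ext fun x => congrArg (fun k : Ahat →A[ℂ] Ahat => k x) h₂)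
      (AlgHom.ext fun x => congrArg (fun k : Ahat →A[ℂ] Ahat => k x) h₁) with
    continuous_toFun := (h.map α).cont
    continuous_invFun := (h.map α.symm).cont }

theorem mapEquiv_apply (h : IsArensMichaelEnvelope iA) (α : A ≃ₐ[ℂ] A) (a : A) :
    h.mapEquiv α (iA a) = iA (α a) :=
  h.map_apply α a

end IsArensMichaelEnvelope

/-! ### The bimodule `A_α` -/

/-- The `A`-bimodule `A_α`: it is `A` as a left module, and `x <• a = x * α a`. -/
def Twist {A : Type*} [Ring A] [Algebra ℂ A] (_α : A ≃ₐ[ℂ] A) : Type _ := A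

namespace Twist

variable {A : Type*} [Ring A] [Algebra ℂ A] (α : A ≃ₐ[ℂ] A)

instance : AddCommGroup (Twist α) := inferInstanceAs (AddCommGroup A)
instance : Module ℂ (Twist α) := inferInstanceAs (Module ℂ A)
instance : Module A (Twist α) := inferInstanceAs (Module A A)
instance [UniformSpace A] : UniformSpace (Twist α) := inferInstanceAs (UniformSpace A)

/-- The identity map `A → A_α`, an isomorphism of left modules and of vector spaces. -/
def mk : A ≃ₗ[ℂ] Twist α := LinearEquiv.refl ℂ A

instance : Module Aᵐᵒᵖ (Twist α) where
  smul a x := mk α ((mk α).symm x * α a.unop)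
  one_smul x := by
    change (mk α).symm x * α 1 = _
    simp
    rfl
  mul_smul a b x := by
    change (mk α).symm x * α (b.unop * a.unop) = ((mk α).symm x * α b.unop) * α a.unop
    simp [mul_assoc]
  smul_zero a := by
    change (0 : A) * α a.unop = 0
    simp
  smul_add a x y := by
    change ((mk α).symm x + (mk α).symm y) * α a.unop = _
    rw [add_mul]
    rfl
  add_smul a b x := by
    change (mk α).symm x * α (a.unop + b.unop) = (mk α).symm x * α a.unop + (mk α).symm x * α b.unop
    simp [mul_add]
  zero_smul x := by
    change (mk α).symm x * α 0 = 0
    simp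

theorem smul_mk (a x : A) : a • mk α x = mk α (a * x) := rfl

theorem mk_smul (x a : A) : mk α x <• a = mk α (x * α a) := rfl

instance : IsBimodule A (Twist α) where
  smul_comm a b x := (mul_assoc (G := A) a ((mk α).symm x) (α b.unop)).symm
  toIsScalarTower := inferInstanceAs (IsScalarTower ℂ A A)
  op_smul_assoc c a x := by
    change (mk α).symm x * α (c • a) = c • ((mk α).symm x * α a)
    simp

end Twist

/-! ### The Laurent Ore extension -/

/-- The infinite cyclic group of exponents, acting on `A` through the powers of `α`. -/
def OreExponent {A : Type*} [Ring A] [Algebra ℂ A] (_α : A ≃ₐ[ℂ] A) : Type := Multiplicative ℤ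

namespace OreExponent

variable {A : Type*} [Ring A] [Algebra ℂ A] (α : A ≃ₐ[ℂ] A)

instance : CommGroup (OreExponent α) := inferInstanceAs (CommGroup (Multiplicative ℤ))

/-- The exponent `n`, acting by `α ^ n`. -/
def of (n : ℤ) : OreExponent α := Multiplicative.ofAdd n

instance : MulSemiringAction (OreExponent α) A :=
  MulSemiringAction.compHom A (zpowersHom (A ≃ₐ[ℂ] A) α : Multiplicative ℤ →* (A ≃ₐ[ℂ] A))

theorem of_smul (n : ℤ) (a : A) : of α n • a = (α ^ n : A ≃ₐ[ℂ] A) a := rfl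

instance : SMulCommClass (OreExponent α) ℂ A where
  smul_comm n c a := map_smul (α ^ (Multiplicative.toAdd n : ℤ) : A ≃ₐ[ℂ] A) c a

end OreExponent

/-- The Laurent Ore extension `A[t, t⁻¹; α]`: finite sums `∑ aᵢ tⁱ` (`i ∈ ℤ`, `aᵢ ∈ A`) with
multiplication `(a tⁱ) * (b tʲ) = a αⁱ(b) tⁱ⁺ʲ`. -/
abbrev LaurentOre {A : Type*} [Ring A] [Algebra ℂ A] (α : A ≃ₐ[ℂ] A) : Type _ :=
  SkewMonoidAlgebra A (OreExponent α)

namespace LaurentOre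

variable {A : Type*} [Ring A] [Algebra ℂ A] (α : A ≃ₐ[ℂ] A)

/-- The monomial `a tⁿ`, as a linear function of `a`. -/
def monomial (n : ℤ) : A →ₗ[ℂ] LaurentOre α where
  toFun a := SkewMonoidAlgebra.single (OreExponent.of α n) a
  map_add' a b := SkewMonoidAlgebra.single_add _ a b
  map_smul' c a := (SkewMonoidAlgebra.smul_single c _ a).symm

theorem monomial_mul (m n : ℤ) (a b : A) :
    monomial α m a * monomial α n b = monomial α (m + n) (a * (α ^ m : A ≃ₐ[ℂ] A) b) :=
  SkewMonoidAlgebra.single_mul_single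

/-- The inclusion `A → A[t, t⁻¹; α]`. -/
def C : A →ₐ[ℂ] LaurentOre α :=
  AlgHom.ofLinearMap (monomial α 0) rfl fun a b => by simp [monomial_mul]

/-- The element `t`. -/
def t : LaurentOre α := monomial α 1 1

/-- The element `t⁻¹`. -/
def tInv : LaurentOre α := monomial α (-1) 1

theorem t_mul_tInv : t α * tInv α = 1 := by
  simp only [t, tInv, monomial_mul, map_one, mul_one]; rfl

theorem tInv_mul_t : tInv α * t α = 1 := by
  simp only [t, tInv, monomial_mul, map_one, mul_one]; rfl

theorem t_mul_C (a : A) : t α * C α a = C α (α a) * t α := by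
  change monomial α 1 1 * monomial α 0 a = monomial α 0 (α a) * monomial α 1 1
  simp [monomial_mul]

end LaurentOre

/-! ### Invertible bimodules and the Laurent tensor algebra -/

section Algebraic

/-- The subspace of `M ⊗[ℂ] N` by which one divides to obtain `M ⊗_A N`. -/
def balancedRel (A M N : Type*) [Ring A] [AddCommGroup M] [Module ℂ M] [Module Aᵐᵒᵖ M]
    [AddCommGroup N] [Module ℂ N] [Module A N] : Submodule ℂ (M ⊗[ℂ] N) :=
  Submodule.span ℂ {z | ∃ (m : M) (a : A) (n : N), z = (m <• a) ⊗ₜ n - m ⊗ₜ (a • n)}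

/-- The subspace of the `ℂ`-tensor power `⨂[ℂ]^n M` by which one divides to obtain the tensor
power `M ⊗_A ⋯ ⊗_A M` (`n` factors, `n ≥ 1`): it is spanned by
`⋯ ⊗ mᵢ a ⊗ mᵢ₊₁ ⊗ ⋯ - ⋯ ⊗ mᵢ ⊗ a mᵢ₊₁ ⊗ ⋯`. -/
def balancedPowRel (A M : Type*) [Ring A] [AddCommGroup M] [Module ℂ M] [Module A M]
    [Module Aᵐᵒᵖ M] (n : ℕ) : Submodule ℂ (⨂[ℂ] _ : Fin n, M) :=
  Submodule.span ℂ {z | ∃ (m : Fin n → M) (i j : Fin n) (a : A), (j : ℕ) = i + 1 ∧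
    z = PiTensorProduct.tprod ℂ (Function.update m i (m i <• a)) -
        PiTensorProduct.tprod ℂ (Function.update m j (a • m j))}

variable (A M N : Type*) [Ring A] [Algebra ℂ A]
  [AddCommGroup M] [Module ℂ M] [Module A M] [Module Aᵐᵒᵖ M] [IsBimodule A M]
  [AddCommGroup N] [Module ℂ N] [Module A N] [Module Aᵐᵒᵖ N] [IsBimodule A N]

/-- A pair of inverse `A`-bimodules `M` and `N = M⁻¹` together with the bimodule isomorphisms
`i₁ : M ⊗_A N ≃ A` and `i₂ : N ⊗_A M ≃ A`, given as balanced bilinear maps which induce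
bijections from `M ⊗_A N = (M ⊗[ℂ] N) / balancedRel` and `N ⊗_A M`. -/
structure InversePair where
  i₁ : M →ₗ[ℂ] N →ₗ[ℂ] A
  i₂ : N →ₗ[ℂ] M →ₗ[ℂ] A
  i₁_smul : ∀ a m n, i₁ (a • m) n = a * i₁ m n
  i₁_op_smul : ∀ a m n, i₁ m (n <• a) = i₁ m n * a
  i₂_smul : ∀ a n m, i₂ (a • n) m = a * i₂ n m
  i₂_op_smul : ∀ a n m, i₂ n (m <• a) = i₂ n m * a
  i₁_surjective : Function.Surjective (TensorProduct.lift i₁)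
  i₂_surjective : Function.Surjective (TensorProduct.lift i₂)
  ker_i₁ : LinearMap.ker (TensorProduct.lift i₁) = balancedRel A M N
  ker_i₂ : LinearMap.ker (TensorProduct.lift i₂) = balancedRel A N M
  assoc₁ : ∀ (m : M) (n : N) (m' : M), i₁ m n • m' = m <• i₂ n m'
  assoc₂ : ∀ (n : N) (m : M) (n' : N), i₂ n m • n' = n <• i₁ m n'

variable {A M N}

/-- A compatible triple `(θ, φ, ψ)` with values in an algebra `L`: a homomorphism `θ : A → L` and
bimodule homomorphisms `φ : M → L`, `ψ : M⁻¹ → L` such that multiplication in `L` restricts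
to `i₁` and `i₂`. -/
structure CompatibleTriple (P : InversePair A M N) (L : Type*) [Ring L] [Algebra ℂ L] where
  θ : A →ₐ[ℂ] L
  φ : M →ₗ[ℂ] L
  ψ : N →ₗ[ℂ] L
  φ_smul : ∀ a m, φ (a • m) = θ a * φ m
  φ_op_smul : ∀ a m, φ (m <• a) = φ m * θ a
  ψ_smul : ∀ a n, ψ (a • n) = θ a * ψ n
  ψ_op_smul : ∀ a n, ψ (n <• a) = ψ n * θ a
  φ_mul_ψ : ∀ m n, φ m * ψ n = θ (P.i₁ m n)
  ψ_mul_φ : ∀ n m, ψ n * φ m = θ (P.i₂ n m)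

/-- The map `M^{⊗ n} → L`, `m₁ ⊗ ⋯ ⊗ mₙ ↦ φ m₁ * ⋯ * φ mₙ`. -/
def powMap {L : Type*} [Ring L] [Algebra ℂ L] (φ : M →ₗ[ℂ] L) (n : ℕ) :
    (⨂[ℂ] _ : Fin n, M) →ₗ[ℂ] L :=
  PiTensorProduct.lift ((MultilinearMap.mkPiAlgebraFin ℂ n L).compLinearMap fun _ => φ)

namespace CompatibleTriple

variable {P : InversePair A M N} {L : Type*} [Ring L] [Algebra ℂ L]

/-- The image in `L` of `M^{⊗ n}`, where `M^{⊗ 0} = A` and `M^{⊗ -n} = (M⁻¹)^{⊗ n}`. -/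
def component (S : CompatibleTriple P L) : ℤ → Submodule ℂ L
  | Int.ofNat 0 => LinearMap.range S.θ.toLinearMap
  | Int.ofNat (n + 1) => LinearMap.range (powMap S.φ (n + 1))
  | Int.negSucc n => LinearMap.range (powMap S.ψ (n + 1))

/-- `L`, with the inclusions `θ`, `φ`, `ψ` of `A`, `M`, `M⁻¹`, is the Laurent tensor algebra
`L_A(M) = ⨁_{n ∈ ℤ} M^{⊗_A n}`: the multiplication of `L` identifies each tensor power
`M^{⊗_A n}` with a subspace of `L`, and `L` is the direct sum of these subspaces. -/
structure IsLaurentTensorAlgebra (S : CompatibleTriple P L) : Prop where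
  θ_injective : Function.Injective S.θ
  ker_φ : ∀ n : ℕ, LinearMap.ker (powMap S.φ (n + 1)) = balancedPowRel A M (n + 1)
  ker_ψ : ∀ n : ℕ, LinearMap.ker (powMap S.ψ (n + 1)) = balancedPowRel A N (n + 1)
  isInternal : DirectSum.IsInternal S.component

end CompatibleTriple

end Algebraic

/-! ### Topologically invertible bimodules and the analytic Laurent tensor algebra -/

section Topological

/-- `β : M × N → F` exhibits `F` as the complete projective tensor product `M ⊗̂_A N`: it is a
jointly continuous balanced bilinear map, and every such map to a complete locally convex space
factors uniquely through it. -/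
structure IsProjTensorProduct (A : Type*) {M N F : Type u} [Ring A]
    [AddCommGroup M] [Module ℂ M] [Module Aᵐᵒᵖ M] [UniformSpace M]
    [AddCommGroup N] [Module ℂ N] [Module A N] [UniformSpace N]
    [AddCommGroup F] [Module ℂ F] [UniformSpace F] (β : M →ₗ[ℂ] N →ₗ[ℂ] F) : Prop where
  complete : IsCompleteLCS F
  continuous : Continuous fun q : M × N => β q.1 q.2
  balanced : ∀ (m : M) (a : A) (n : N), β (m <• a) n = β m (a • n)
  universal : ∀ (E : Type u) [AddCommGroup E] [Module ℂ E] [UniformSpace E] [IsCompleteLCS E]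
    (γ : M →ₗ[ℂ] N →ₗ[ℂ] E), (Continuous fun q : M × N => γ q.1 q.2) →
    (∀ (m : M) (a : A) (n : N), γ (m <• a) n = γ m (a • n)) →
    ∃! f : F →L[ℂ] E, ∀ m n, f (β m n) = γ m n

variable (A M N : Type u) [Ring A] [Algebra ℂ A] [UniformSpace A]
  [AddCommGroup M] [Module ℂ M] [Module A M] [Module Aᵐᵒᵖ M] [UniformSpace M]
  [AddCommGroup N] [Module ℂ N] [Module A N] [Module Aᵐᵒᵖ N] [UniformSpace N]

/-- A pair of topologically inverse `A`-`⊗̂`-bimodules `M` and `N = M⁻¹` together with the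
topological bimodule isomorphisms `i₁ : M ⊗̂_A N ≃ A` and `i₂ : N ⊗̂_A M ≃ A`, given as the
corresponding universal balanced bilinear maps. The associativity diagrams are stated on
elementary tensors, whose span is dense. -/
structure TopInversePair where
  left : IsTopBimodule A M
  right : IsTopBimodule A N
  i₁ : M →ₗ[ℂ] N →ₗ[ℂ] A
  i₂ : N →ₗ[ℂ] M →ₗ[ℂ] A
  i₁_smul : ∀ a m n, i₁ (a • m) n = a * i₁ m n
  i₁_op_smul : ∀ a m n, i₁ m (n <• a) = i₁ m n * a
  i₂_smul : ∀ a n m, i₂ (a • n) m = a * i₂ n m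
  i₂_op_smul : ∀ a n m, i₂ n (m <• a) = i₂ n m * a
  i₁_iso : IsProjTensorProduct A i₁
  i₂_iso : IsProjTensorProduct A i₂
  assoc₁ : ∀ (m : M) (n : N) (m' : M), i₁ m n • m' = m <• i₂ n m'
  assoc₂ : ∀ (n : N) (m : M) (n' : N), i₂ n m • n' = n <• i₁ m n'

variable {A M N}

/-- A topologically compatible triple `(θ, φ, ψ)` with values in `B`: a continuous homomorphism
`θ : A → B` and continuous bimodule homomorphisms `φ : M → B`, `ψ : M⁻¹ → B` such that
`m ∘ (φ ⊗̂ ψ) = θ ∘ i₁` and `m ∘ (ψ ⊗̂ φ) = θ ∘ i₂` (stated on elementary tensors, whose span is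
dense). -/
structure TopCompatibleTriple (P : TopInversePair A M N)
    (B : Type*) [Ring B] [Algebra ℂ B] [UniformSpace B] where
  θ : A →A[ℂ] B
  φ : M →L[ℂ] B
  ψ : N →L[ℂ] B
  φ_smul : ∀ a m, φ (a • m) = θ a * φ m
  φ_op_smul : ∀ a m, φ (m <• a) = φ m * θ a
  ψ_smul : ∀ a n, ψ (a • n) = θ a * ψ n
  ψ_op_smul : ∀ a n, ψ (n <• a) = ψ n * θ a
  φ_mul_ψ : ∀ m n, φ m * ψ n = θ (P.i₁ m n)
  ψ_mul_φ : ∀ n m, ψ n * φ m = θ (P.i₂ n m)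

/-- `L`, with the triple `T`, is the analytic Laurent tensor algebra `L̂_A(M)`: `L` is an
Arens–Michael algebra and every topologically compatible triple with values in an Arens–Michael
algebra `B` factors through `T` by a unique continuous homomorphism `L → B`. -/
def TopCompatibleTriple.IsAnalyticLaurentTensorAlgebra {P : TopInversePair A M N}
    {L : Type u} [Ring L] [Algebra ℂ L] [UniformSpace L] [IsArensMichaelAlgebra L]
    (T : TopCompatibleTriple P L) : Prop :=
  ∀ (B : Type u) [Ring B] [Algebra ℂ B] [UniformSpace B] [IsArensMichaelAlgebra B]
    (T' : TopCompatibleTriple P B), ∃! f : L →A[ℂ] B,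
      (∀ a, f (T.θ a) = T'.θ a) ∧ (∀ m, f (T.φ m) = T'.φ m) ∧ (∀ n, f (T.ψ n) = T'.ψ n)

end Topological

/-! ### The inverse bimodules `A_α` and `A_{α⁻¹}` -/

namespace Twist

section

variable {A : Type*} [Ring A] [Algebra ℂ A] (α : A ≃ₐ[ℂ] A)

/-- The map `A_α × A_{α⁻¹} → A`, `(x, y) ↦ x α(y)`. -/
def pairing₁ : Twist α →ₗ[ℂ] Twist α.symm →ₗ[ℂ] A :=
  (LinearMap.mul ℂ A).compl₁₂ (mk α).symm.toLinearMap
    (α.toLinearMap ∘ₗ (mk α.symm).symm.toLinearMap)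

/-- The map `A_{α⁻¹} × A_α → A`, `(y, x) ↦ y α⁻¹(x)`. -/
def pairing₂ : Twist α.symm →ₗ[ℂ] Twist α →ₗ[ℂ] A :=
  (LinearMap.mul ℂ A).compl₁₂ (mk α.symm).symm.toLinearMap
    (α.symm.toLinearMap ∘ₗ (mk α).symm.toLinearMap)

theorem pairing₁_mk (x y : A) : pairing₁ α (mk α x) (mk α.symm y) = x * α y := rfl

theorem pairing₂_mk (y x : A) : pairing₂ α (mk α.symm y) (mk α x) = y * α.symm x := rfl

theorem pairing₁_smul (a : A) (m : Twist α) (n : Twist α.symm) :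
    pairing₁ α (a • m) n = a * pairing₁ α m n :=
  mul_assoc (G := A) a ((mk α).symm m) (α ((mk α.symm).symm n))

theorem pairing₁_op_smul (a : A) (m : Twist α) (n : Twist α.symm) :
    pairing₁ α m (n <• a) = pairing₁ α m n * a := by
  change (mk α).symm m * α ((mk α.symm).symm n * α.symm a) =
    (mk α).symm m * α ((mk α.symm).symm n) * a
  simp [mul_assoc]

theorem pairing₁_balanced (m : Twist α) (a : A) (n : Twist α.symm) :
    pairing₁ α (m <• a) n = pairing₁ α m (a • n) := by
  change (mk α).symm m * α a * α ((mk α.symm).symm n) =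
    (mk α).symm m * α (a * (mk α.symm).symm n)
  simp [mul_assoc]

theorem pairing₁_surjective : Function.Surjective (TensorProduct.lift (pairing₁ α)) := fun a =>
  ⟨mk α a ⊗ₜ mk α.symm 1, by simp [pairing₁_mk]⟩

theorem ker_pairing₁ : LinearMap.ker (TensorProduct.lift (pairing₁ α)) =
    balancedRel A (Twist α) (Twist α.symm) := by
  apply le_antisymm
  · have key : ∀ z : Twist α ⊗[ℂ] Twist α.symm,
        z - mk α (TensorProduct.lift (pairing₁ α) z) ⊗ₜ mk α.symm 1 ∈
          balancedRel A (Twist α) (Twist α.symm) := by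
      intro z
      induction z using TensorProduct.induction_on with
      | zero => simp
      | tmul x y =>
        have h : (x <• ((mk α.symm).symm y) : Twist α) ⊗ₜ[ℂ] mk α.symm 1 -
            x ⊗ₜ[ℂ] (((mk α.symm).symm y) • mk α.symm 1) ∈
            balancedRel A (Twist α) (Twist α.symm) := Submodule.subset_span ⟨_, _, _, rfl⟩
        have h2 : ((mk α.symm).symm y) • mk α.symm 1 = y :=
          mul_one (M := A) ((mk α.symm).symm y)
        rw [h2] at h
        rw [← neg_mem_iff, neg_sub]
        exact h
      | add x y hx hy =>
        rw [map_add, map_add, TensorProduct.add_tmul, add_sub_add_comm]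
        exact add_mem hx hy
    intro z hz
    have := key z
    rw [LinearMap.mem_ker] at hz
    simpa [hz] using this
  · refine Submodule.span_le.2 ?_
    rintro _ ⟨m, a, n, rfl⟩
    simp [pairing₁_balanced]

theorem pairing_assoc₁ (m : Twist α) (n : Twist α.symm) (m' : Twist α) :
    pairing₁ α m n • m' = m <• pairing₂ α n m' := by
  change (mk α).symm m * α ((mk α.symm).symm n) * (mk α).symm m' =
    (mk α).symm m * α ((mk α.symm).symm n * α.symm ((mk α).symm m'))
  simp [mul_assoc]

/-- `A_α` and `A_{α⁻¹}` are inverse bimodules. -/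
def inversePair : InversePair A (Twist α) (Twist α.symm) where
  i₁ := pairing₁ α
  i₂ := pairing₂ α
  i₁_smul := pairing₁_smul α
  i₁_op_smul := pairing₁_op_smul α
  i₂_smul := pairing₁_smul α.symm
  i₂_op_smul := pairing₁_op_smul α.symm
  i₁_surjective := pairing₁_surjective α
  i₂_surjective := pairing₁_surjective α.symm
  ker_i₁ := ker_pairing₁ α
  ker_i₂ := ker_pairing₁ α.symm
  assoc₁ := pairing_assoc₁ α
  assoc₂ := pairing_assoc₁ α.symm

end

section

variable {A : Type u} [Ring A] [Algebra ℂ A] [UniformSpace A] [hA : IsArensMichaelAlgebra A]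

theorem continuous_mul_of_isArensMichaelAlgebra : Continuous fun q : A × A => q.1 * q.2 := by
  obtain ⟨P, hP, hp⟩ := hA.exists_seminorms
  suffices h : IsTopologicalRing A from continuous_mul
  refine IsTopologicalRing.of_addGroup_of_nhds_zero ?_ (fun a => ?_) (fun a => ?_)
  · rw [hp.tendsto_nhds]
    intro i ε hε
    have hball : ∀ᶠ x in 𝓝 (0 : A), i.1 x < min ε 1 := by
      have := (hp.tendsto_nhds (fun x : A => x) 0).1 Filter.tendsto_id i _ (lt_min hε one_pos)
      simpa using this
    filter_upwards [hball.prod_mk hball] with q hq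
    have h1 : i.1 q.1 < ε := hq.1.trans_le (min_le_left _ _)
    have h2 : i.1 q.2 ≤ 1 := (hq.2.trans_le (min_le_right _ _)).le
    rw [sub_zero]
    calc i.1 (q.1 * q.2) ≤ i.1 q.1 * i.1 q.2 := hP _ i.2 _ _
      _ ≤ i.1 q.1 := mul_le_of_le_one_right (apply_nonneg _ _) h2
      _ < ε := h1
  all_goals
    rw [hp.tendsto_nhds]
    intro i ε hε
    have hpos : 0 < i.1 a + 1 := add_pos_of_nonneg_of_pos (apply_nonneg _ _) one_pos
    have hball : ∀ᶠ x in 𝓝 (0 : A), i.1 x < ε / (i.1 a + 1) := by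
      have := (hp.tendsto_nhds (fun x : A => x) 0).1 Filter.tendsto_id i _ (div_pos hε hpos)
      simpa using this
    filter_upwards [hball] with x hx
    rw [lt_div_iff₀ hpos] at hx
    have h0 : 0 ≤ i.1 x := apply_nonneg _ _
    have h1 := hP _ i.2 a x
    have h2 := hP _ i.2 x a
    rw [sub_zero]
    nlinarith

theorem isCompleteLCS_of_isArensMichaelAlgebra : IsCompleteLCS A := by
  obtain ⟨P, -, hp⟩ := hA.exists_seminorms
  have h₁ : ContinuousSMul ℂ A := hp.continuousSMul
  have h₂ : LocallyConvexSpace ℝ A := hp.toLocallyConvexSpace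
  exact { }

theorem isTopBimodule (α : A ≃ₐ[ℂ] A) (hα : Continuous α) : IsTopBimodule A (Twist α) where
  toIsCompleteLCS := isCompleteLCS_of_isArensMichaelAlgebra (A := A)
  continuous_left := continuous_mul_of_isArensMichaelAlgebra (A := A)
  continuous_right := (continuous_mul_of_isArensMichaelAlgebra (A := A)).comp
    (continuous_fst.prodMk (hα.comp continuous_snd))

theorem pairing₁_isProjTensorProduct (α : A ≃ₐ[ℂ] A) (hα : Continuous α) :
    IsProjTensorProduct A (pairing₁ α) where
  complete := isCompleteLCS_of_isArensMichaelAlgebra (A := A)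
  continuous := (continuous_mul_of_isArensMichaelAlgebra (A := A)).comp
    (continuous_fst.prodMk (hα.comp continuous_snd))
  balanced := pairing₁_balanced α
  universal := by
    intro E _ _ _ _ γ hγ hb
    refine ⟨⟨γ.flip (mk α.symm 1) ∘ₗ (mk α).toLinearMap,
      hγ.comp (continuous_id.prodMk continuous_const)⟩, fun m n => ?_, fun f hf => ?_⟩
    · have h := hb m ((mk α.symm).symm n) (mk α.symm 1)
      have h2 : ((mk α.symm).symm n) • mk α.symm 1 = n :=
        mul_one (M := A) ((mk α.symm).symm n)
      rw [h2] at h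
      exact h
    · ext a
      have h := hf (mk α a) (mk α.symm 1)
      rw [pairing₁_mk, map_one, mul_one] at h
      exact h

/-- For a topological automorphism `α` of an Arens–Michael algebra `A`, `A_α` and `A_{α⁻¹}` are
topologically inverse bimodules. -/
def topInversePair (α : A ≃A[ℂ] A) :
    TopInversePair A (Twist α.toAlgEquiv) (Twist α.toAlgEquiv.symm) where
  left := isTopBimodule _ α.continuous
  right := isTopBimodule _ α.symm.continuous
  i₁ := pairing₁ α.toAlgEquiv
  i₂ := pairing₂ α.toAlgEquiv
  i₁_smul := pairing₁_smul α.toAlgEquiv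
  i₁_op_smul := pairing₁_op_smul α.toAlgEquiv
  i₂_smul := pairing₁_smul α.toAlgEquiv.symm
  i₂_op_smul := pairing₁_op_smul α.toAlgEquiv.symm
  i₁_iso := pairing₁_isProjTensorProduct _ α.continuous
  i₂_iso := pairing₁_isProjTensorProduct _ α.symm.continuous
  assoc₁ := pairing_assoc₁ α.toAlgEquiv
  assoc₂ := pairing_assoc₁ α.toAlgEquiv.symm

end

end Twist

/-! ### `A[t, t⁻¹; α]` as a compatible triple -/

/-- The inclusions of `A`, `A_α = A t` and `A_{α⁻¹} = A t⁻¹` into `A[t, t⁻¹; α]`. -/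
def LaurentOre.triple {A : Type*} [Ring A] [Algebra ℂ A] (α : A ≃ₐ[ℂ] A) :
    CompatibleTriple (Twist.inversePair α) (LaurentOre α) where
  θ := C α
  φ := monomial α 1 ∘ₗ (Twist.mk α).symm.toLinearMap
  ψ := monomial α (-1) ∘ₗ (Twist.mk α.symm).symm.toLinearMap
  φ_smul a m := by
    change monomial α 1 (a * (Twist.mk α).symm m) =
      monomial α 0 a * monomial α 1 ((Twist.mk α).symm m)
    simp [monomial_mul]
  φ_op_smul a m := by
    change monomial α 1 ((Twist.mk α).symm m * α a) =
      monomial α 1 ((Twist.mk α).symm m) * monomial α 0 a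
    simp [monomial_mul]
  ψ_smul a n := by
    change monomial α (-1) (a * (Twist.mk α.symm).symm n) =
      monomial α 0 a * monomial α (-1) ((Twist.mk α.symm).symm n)
    simp [monomial_mul]
  ψ_op_smul a n := by
    change monomial α (-1) ((Twist.mk α.symm).symm n * α.symm a) =
      monomial α (-1) ((Twist.mk α.symm).symm n) * monomial α 0 a
    simp [monomial_mul]
  φ_mul_ψ m n := by
    change monomial α 1 ((Twist.mk α).symm m) * monomial α (-1) ((Twist.mk α.symm).symm n) =
      monomial α 0 ((Twist.mk α).symm m * α ((Twist.mk α.symm).symm n))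
    simp [monomial_mul]
  ψ_mul_φ n m := by
    change monomial α (-1) ((Twist.mk α.symm).symm n) * monomial α 1 ((Twist.mk α).symm m) =
      monomial α 0 ((Twist.mk α.symm).symm n * α.symm ((Twist.mk α).symm m))
    simp [monomial_mul]

end

/-!
An Arens–Michael algebra `B` receives the same data from both sides of the isomorphism. A
homomorphism `A[t, t⁻¹; α] → B` is a homomorphism `f : A → B` together with a unit `u` of `B` (the
image of `t`) such that `u f(a) = f(α(a)) u` (`LaurentOre.lift`, `LaurentOre.algHom_ext`). A
topologically compatible triple over the envelope `Â` is a continuous homomorphism `θ : Â → B`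
together with a unit `u = φ(1)` such that `u θ(x) = θ(α̂(x)) u`, because `φ(x) = θ(x) φ(1)`,
`ψ(y) = θ(y) ψ(1)` and `ψ(1)` is inverse to `φ(1)`
(`TopCompatibleTriple.isAnalyticLaurentTensorAlgebra_iff`). The homomorphisms `f` correspond to the
continuous homomorphisms `θ` by the universal property of `Â`, and the commutation relation passes
from `A` to `Â` since `x ↦ u θ(x) u⁻¹` and `θ ∘ α̂` are continuous and agree on the image of `A`
(`IsArensMichaelEnvelope.unit_mul_map`).

The analytic Laurent tensor algebra exists because one can complete `Â[t, t⁻¹; α̂]` with respect to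
all submultiplicative seminorms which are continuous on `Â` (`exists_arensMichael_completion`).

On the algebraic side, every element of `A_α ⊗_A ⋯ ⊗_A A_α` has the form `a ⊗ 1 ⊗ ⋯ ⊗ 1`
(`Twist.exists_sub_headTensor_mem`), which multiplication sends to the monomial `a tⁿ`. Hence a
compatible triple over `A_α` is a Laurent tensor algebra if and only if the canonical map from
`A[t, t⁻¹; α]` is bijective (`CompatibleTriple.isLaurentTensorAlgebra_of_bijective`,
`CompatibleTriple.IsLaurentTensorAlgebra.bijective`).
-/

noncomputable section

/-! ### Completions of algebras with submultiplicative seminorms -/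

open UniformSpace in
/-- The extension of a uniformly continuous seminorm to the completion. -/
def Seminorm.completion {E : Type*} [AddCommGroup E] [Module ℂ E] [UniformSpace E]
    [IsUniformAddGroup E] [UniformContinuousConstSMul ℂ E] (p : Seminorm ℂ E)
    (hp : UniformContinuous p) : Seminorm ℂ (Completion E) :=
  have hc : Continuous (Completion.extension p) := Completion.continuous_extension
  Seminorm.of (Completion.extension p)
    (fun x y => by
      refine Completion.induction_on₂ x y ?_ fun x y => ?_
      · exact isClosed_le (hc.comp continuous_add)
          ((hc.comp continuous_fst).add (hc.comp continuous_snd))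
      · rw [← Completion.coe_add]
        simpa only [Completion.extension_coe hp] using map_add_le_add p x y)
    (fun c x => by
      refine Completion.induction_on x ?_ fun x => ?_
      · exact isClosed_eq (hc.comp (continuous_const_smul c)) (continuous_const.mul hc)
      · rw [← Completion.coe_smul]
        simpa only [Completion.extension_coe hp] using map_smul_eq_mul p c x)

section Completion

open UniformSpace

variable {R : Type u} [Ring R] [Algebra ℂ R] [UniformSpace R] [IsUniformAddGroup R]

theorem Seminorm.completion_coe [UniformContinuousConstSMul ℂ R] (p : Seminorm ℂ R)
    (hp : UniformContinuous p) (x : R) : p.completion hp (x : Completion R) = p x :=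
  Completion.extension_coe hp x

theorem Seminorm.continuous_completion [UniformContinuousConstSMul ℂ R] (p : Seminorm ℂ R)
    (hp : UniformContinuous p) : Continuous (p.completion hp) :=
  Completion.continuous_extension

theorem Seminorm.completion_mul_le [UniformContinuousConstSMul ℂ R] [IsTopologicalRing R]
    (p : Seminorm ℂ R) (hp : UniformContinuous p) (hm : ∀ x y, p (x * y) ≤ p x * p y)
    (x y : Completion R) :
    p.completion hp (x * y) ≤ p.completion hp x * p.completion hp y := by
  have hc := p.continuous_completion hp
  refine Completion.induction_on₂ x y ?_ fun x y => ?_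
  · exact isClosed_le (hc.comp continuous_mul)
      ((hc.comp continuous_fst).mul (hc.comp continuous_snd))
  · rw [← Completion.coe_mul]
    simpa only [completion_coe] using hm x y

/-- The extended seminorms define the topology of the completion. -/
theorem WithSeminorms.completion [UniformContinuousConstSMul ℂ R] {ι : Type*}
    {p : SeminormFamily ℂ R ι} (hp : WithSeminorms p) (hu : ∀ i, UniformContinuous (p i)) :
    WithSeminorms fun i => (p i).completion (hu i) := by
  rw [SeminormFamily.withSeminorms_iff_nhds_eq_iInf]
  refine le_antisymm (le_iInf fun i => ?_) fun U hU => ?_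
  · rw [← Filter.tendsto_iff_comap]
    simpa using ((p i).continuous_completion (hu i)).tendsto 0
  · obtain ⟨V, hV, hVc, hVU⟩ := exists_mem_nhds_isClosed_subset hU
    have hV' : (fun x : R => (x : Completion R)) ⁻¹' V ∈ 𝓝 0 :=
      (Completion.continuous_coe R).continuousAt.preimage_mem_nhds hV
    obtain ⟨⟨s, r⟩, hr, hs⟩ := hp.hasBasis_zero_ball.mem_iff.1 hV'
    have hr : 0 < r := hr
    have hset : {x : Completion R | ∀ i ∈ s, (p i).completion (hu i) x < r} =
        ⋂ i ∈ s, {x | (p i).completion (hu i) x < r} := by ext; simp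
    have hopen : IsOpen {x : Completion R | ∀ i ∈ s, (p i).completion (hu i) x < r} := by
      rw [hset]
      exact isOpen_biInter_finset fun i _ =>
        isOpen_lt ((p i).continuous_completion (hu i)) continuous_const
    -- `R` is dense, so this open set lies in the closure of its trace on `R`, and `V` is closed
    have hsub : {x : Completion R | ∀ i ∈ s, (p i).completion (hu i) x < r} ⊆ V := by
      refine (Completion.denseRange_coe.open_subset_closure_inter hopen).trans
        (hVc.closure_subset_iff.2 ?_)
      rintro _ ⟨hx, x, rfl⟩
      refine hs ?_
      rw [Seminorm.mem_ball_zero]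
      refine Seminorm.finset_sup_apply_lt hr fun i hi => ?_
      simpa only [Seminorm.completion_coe] using hx i hi
    refine Filter.mem_of_superset ?_ (hsub.trans hVU)
    rw [hset]
    refine (Filter.biInter_finset_mem s).2 fun i _ => ?_
    exact Filter.mem_iInf_of_mem i ⟨Set.Iio r, Iio_mem_nhds hr, fun _ h => h⟩

/-- Multiplication is jointly continuous as soon as submultiplicative seminorms define the
topology; neither completeness nor separation is needed. -/
theorem WithSeminorms.isTopologicalRing {ι : Type*} {p : SeminormFamily ℂ R ι}
    (hp : WithSeminorms p) (hm : ∀ i x y, p i (x * y) ≤ p i x * p i y) : IsTopologicalRing R := by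
  have hball (i : ι) {ε : ℝ} (hε : 0 < ε) : ∀ᶠ x in 𝓝 (0 : R), p i x < ε := by
    simpa using (hp.tendsto_nhds (fun x : R => x) 0).1 Filter.tendsto_id i ε hε
  refine IsTopologicalRing.of_addGroup_of_nhds_zero ?_ (fun a => ?_) (fun a => ?_)
  · rw [hp.tendsto_nhds]
    intro i ε hε
    filter_upwards [(hball i hε).prod_mk (hball i one_pos)] with q hq
    rw [sub_zero]
    calc p i (q.1 * q.2) ≤ p i q.1 * p i q.2 := hm ..
      _ ≤ p i q.1 := mul_le_of_le_one_right (apply_nonneg _ _) hq.2.le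
      _ < ε := hq.1
  all_goals
    rw [hp.tendsto_nhds]
    intro i ε hε
    have hpos : 0 < p i a + 1 := by positivity
    filter_upwards [hball i (div_pos hε hpos)] with x hx
    rw [lt_div_iff₀ hpos] at hx
    have h0 : 0 ≤ p i x := apply_nonneg _ _
    have h1 := hm i a x
    have h2 := hm i x a
    rw [sub_zero]
    nlinarith

theorem isArensMichaelAlgebra_completion [UniformContinuousConstSMul ℂ R] [IsTopologicalRing R]
    {P : Set (Seminorm ℂ R)} (hm : ∀ p ∈ P, ∀ x y, p (x * y) ≤ p x * p y)
    (hp : WithSeminorms fun p : P => (p : Seminorm ℂ R)) :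
    IsArensMichaelAlgebra (Completion R) where
  exists_seminorms := by
    have hu (p : P) : UniformContinuous (p : Seminorm ℂ R) :=
      Seminorm.uniformContinuous_of_continuousAt_zero (hp.continuous_seminorm p).continuousAt
    refine ⟨Set.range fun p : P => p.1.completion (hu p), ?_, ?_⟩
    · rintro _ ⟨p, rfl⟩
      exact p.1.completion_mul_le _ (hm p.1 p.2)
    · refine (hp.completion hu).congr ?_ ?_
      · rintro ⟨_, p, rfl⟩
        exact ⟨{p}, 1, by simp⟩
      · exact fun p => ⟨{⟨_, p, rfl⟩}, 1, by simp⟩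

end Completion

instance {B : Type*} [Ring B] [Algebra ℂ B] [UniformSpace B] [IsArensMichaelAlgebra B] :
    IsTopologicalRing B := by
  obtain ⟨P, hm, hp⟩ := IsArensMichaelAlgebra.exists_seminorms (B := B)
  exact hp.isTopologicalRing fun i => hm i i.2

instance {B : Type*} [Ring B] [Algebra ℂ B] [UniformSpace B] [IsArensMichaelAlgebra B] :
    ContinuousSMul ℂ B := by
  obtain ⟨P, -, hp⟩ := IsArensMichaelAlgebra.exists_seminorms (B := B)
  exact hp.continuousSMul

/-- The Hausdorff completion of an algebra `R` with respect to a set `P` of submultiplicative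
seminorms: homomorphisms from `R` to an Arens–Michael algebra extend to it if they pull back
continuous submultiplicative seminorms into `P`. -/
theorem exists_arensMichael_completion {R : Type u} [Ring R] [Algebra ℂ R]
    {P : Set (Seminorm ℂ R)} (hm : ∀ p ∈ P, ∀ x y, p (x * y) ≤ p x * p y) :
    ∃ (L : Type u) (_ : Ring L) (_ : Algebra ℂ L) (_ : UniformSpace L)
      (_ : IsArensMichaelAlgebra L) (ι : R →ₐ[ℂ] L), DenseRange ι ∧
      (∀ {V : Type u} [AddCommGroup V] [Module ℂ V] [TopologicalSpace V] [IsTopologicalAddGroup V]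
        (f : V →ₗ[ℂ] R), (∀ p ∈ P, Continuous fun v => p (f v)) → Continuous fun v => ι (f v)) ∧
      ∀ (B : Type u) [Ring B] [Algebra ℂ B] [UniformSpace B] [IsArensMichaelAlgebra B]
        (f : R →ₐ[ℂ] B),
        (∀ q : Seminorm ℂ B, Continuous q → (∀ x y, q (x * y) ≤ q x * q y) →
          q.comp f.toLinearMap ∈ P) →
        ∃ g : L →A[ℂ] B, ∀ x, g (ι x) = f x := by
  let p : SeminormFamily ℂ R P := fun p => p.1
  let _ : TopologicalSpace R := p.moduleFilterBasis.topology
  have hp : WithSeminorms p := ⟨rfl⟩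
  have := hp.topologicalAddGroup
  let _ : UniformSpace R := IsTopologicalAddGroup.rightUniformSpace R
  have : IsUniformAddGroup R := isUniformAddGroup_of_addCommGroup
  have := hp.continuousSMul
  have : UniformContinuousConstSMul ℂ R :=
    uniformContinuousConstSMul_of_continuousConstSMul ℂ R
  have : IsTopologicalRing R := hp.isTopologicalRing fun i => hm i i.2
  let ι : R →ₐ[ℂ] UniformSpace.Completion R :=
    { UniformSpace.Completion.coeRingHom with commutes' := fun _ => rfl }
  refine ⟨UniformSpace.Completion R, inferInstance, inferInstance, inferInstance,
    isArensMichaelAlgebra_completion hm hp, ι, UniformSpace.Completion.denseRange_coe, ?_, ?_⟩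
  · intro V _ _ _ _ f hf
    exact (UniformSpace.Completion.continuous_coe R).comp
      (hp.continuous_of_continuous_comp f fun i => hf i i.2)
  · intro B _ _ _ _ f hf
    obtain ⟨Q, hQ, hq⟩ := IsArensMichaelAlgebra.exists_seminorms (B := B)
    have hc : Continuous f := hq.continuous_of_continuous_comp f.toLinearMap fun i =>
      hp.continuous_seminorm ⟨_, hf i (hq.continuous_seminorm i) (hQ i i.2)⟩
    let g := UniformSpace.Completion.extensionHom (f : R →+* B) hc
    have hg (x : R) : g x = f x := UniformSpace.Completion.extensionHom_coe (f : R →+* B) hc x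
    exact ⟨{ g with
      commutes' := fun c => (hg _).trans (f.commutes c)
      cont := UniformSpace.Completion.continuous_extension }, hg⟩

/-! ### Homomorphisms out of the Laurent Ore extension -/

namespace LaurentOre

variable {A : Type*} [Ring A] [Algebra ℂ A] (α : A ≃ₐ[ℂ] A)

/-- The unit `t` of `A[t, t⁻¹; α]`. -/
def tUnit : (LaurentOre α)ˣ := ⟨t α, tInv α, t_mul_tInv α, tInv_mul_t α⟩

theorem tUnit_zpow (n : ℤ) : (↑(tUnit α ^ n) : LaurentOre α) = monomial α n 1 := by
  induction n using Int.induction_on with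
  | zero => rfl
  | succ n ih =>
    rw [zpow_add_one, Units.val_mul, ih]
    change monomial α n 1 * monomial α 1 1 = _
    simp [monomial_mul]
  | pred n ih =>
    rw [zpow_sub_one, Units.val_mul, ih]
    change monomial α _ 1 * monomial α (-1) 1 = _
    simp [monomial_mul, sub_eq_add_neg]

theorem monomial_eq (n : ℤ) (a : A) : monomial α n a = C α a * ↑(tUnit α ^ n) := by
  rw [tUnit_zpow]
  change _ = monomial α 0 a * _
  simp [monomial_mul]

variable {α} {B : Type*} [Ring B] [Algebra ℂ B]

theorem zpow_mul_map {f : A →ₐ[ℂ] B} {u : Bˣ} (hu : ∀ a, u * f a = f (α a) * u) (n : ℤ) (a : A) :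
    ↑(u ^ n) * f a = f ((α ^ n : A ≃ₐ[ℂ] A) a) * ↑(u ^ n) := by
  have hu' (a : A) : ↑u⁻¹ * f a = f (α⁻¹ a) * ↑u⁻¹ := by
    rw [Units.inv_mul_eq_iff_eq_mul, ← mul_assoc, hu, mul_assoc, Units.mul_inv, mul_one]
    exact congrArg f (α.apply_symm_apply a).symm
  induction n using Int.induction_on generalizing a with
  | zero => simp
  | succ n ih =>
    rw [zpow_add_one, zpow_add_one, Units.val_mul, mul_assoc, hu, ← mul_assoc, ih, mul_assoc]
    rfl
  | pred n ih =>
    rw [zpow_sub_one, zpow_sub_one, Units.val_mul, mul_assoc, hu', ← mul_assoc, ih, mul_assoc]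
    rfl

/-- The homomorphism `A[t, t⁻¹; α] → B` given by a homomorphism `f : A → B` and the image `u` of
`t`, a unit which satisfies the commutation rule of `t`. -/
def lift (f : A →ₐ[ℂ] B) (u : Bˣ) (hu : ∀ a, u * f a = f (α a) * u) : LaurentOre α →ₐ[ℂ] B :=
  let g : OreExponent α →* B :=
    (Units.coeHom B).comp (zpowersHom Bˣ u : Multiplicative ℤ →* Bˣ)
  let F : LaurentOre α →+* B := SkewMonoidAlgebra.liftNCRingHom (f : A →+* B) g
    fun {a n} => (zpow_mul_map hu (Multiplicative.toAdd n) a).symm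
  { F with
    commutes' c := by
      have h : F (C α (algebraMap ℂ A c)) = f (algebraMap ℂ A c) * g 1 :=
        SkewMonoidAlgebra.liftNC_single (f : A →+ B) g 1 _
      rw [map_one, mul_one, AlgHom.commutes, AlgHom.commutes] at h
      exact h }

theorem lift_monomial (f : A →ₐ[ℂ] B) (u : Bˣ) (hu : ∀ a, u * f a = f (α a) * u) (n : ℤ) (a : A) :
    lift f u hu (monomial α n a) = f a * ↑(u ^ n) :=
  SkewMonoidAlgebra.liftNC_single (f : A →+ B)
    ((Units.coeHom B).comp (zpowersHom Bˣ u : Multiplicative ℤ →* Bˣ)) (OreExponent.of α n) a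

theorem lift_C (f : A →ₐ[ℂ] B) (u : Bˣ) (hu : ∀ a, u * f a = f (α a) * u) (a : A) :
    lift f u hu (C α a) = f a := by
  exact (lift_monomial f u hu 0 a).trans (by simp)

theorem lift_t (f : A →ₐ[ℂ] B) (u : Bˣ) (hu : ∀ a, u * f a = f (α a) * u) :
    lift f u hu (t α) = u := by
  exact (lift_monomial f u hu 1 1).trans (by simp)

theorem lift_tInv (f : A →ₐ[ℂ] B) (u : Bˣ) (hu : ∀ a, u * f a = f (α a) * u) :
    lift f u hu (tInv α) = ↑u⁻¹ := by
  exact (lift_monomial f u hu (-1) 1).trans (by simp)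

theorem eq_sum_monomial (x : LaurentOre α) :
    x = ∑ g ∈ x.support, monomial α (Multiplicative.toAdd g) (x.coeff g) :=
  (SkewMonoidAlgebra.sum_single x).symm

theorem eq_zero_of_sum_monomial_eq_zero (s : Finset ℤ) (a : ℤ → A)
    (h : ∑ n ∈ s, monomial α n (a n) = 0) : ∀ n ∈ s, a n = 0 := by
  intro n hn
  have hc := congrArg (fun x : LaurentOre α =>
    SkewMonoidAlgebra.coeffAddEquiv x (OreExponent.of α n)) h
  rw [map_sum, Finsupp.finsetSum_apply, Finset.sum_eq_single n] at hc
  · have : a n = SkewMonoidAlgebra.coeffAddEquiv (monomial α n (a n)) (OreExponent.of α n) :=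
      (Finsupp.single_eq_same (a := OreExponent.of α n)).symm
    rw [this, hc]
    simp
  · exact fun m _ hm => Finsupp.single_eq_of_ne' (a := OreExponent.of α m) hm
  · exact fun hn' => absurd hn hn'

theorem algHom_ext {f g : LaurentOre α →ₐ[ℂ] B} (hC : ∀ a, f (C α a) = g (C α a))
    (ht : f (t α) = g (t α)) : f = g := by
  have hu : Units.map (f : LaurentOre α →* B) (tUnit α) =
      Units.map (g : LaurentOre α →* B) (tUnit α) := Units.ext ht
  have hn (n : ℤ) : f ↑(tUnit α ^ n) = g ↑(tUnit α ^ n) := by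
    have h := congrArg (fun u : Bˣ => (↑(u ^ n) : B)) hu
    simp only [← map_zpow, Units.coe_map] at h
    exact h
  ext x
  rw [eq_sum_monomial x, map_sum, map_sum]
  refine Finset.sum_congr rfl fun n _ => ?_
  rw [monomial_eq, map_mul, map_mul, hC, hn]

end LaurentOre

/-! ### Tensor powers of the twisted bimodule -/

section TensorPower

/-- An ordered product does not change when two adjacent factors are replaced by factors with
the same product. -/
theorem List.prod_ofFn_eq_of_adjacent {L : Type*} [Monoid L] {n : ℕ} {f g : Fin n → L}
    {i j : Fin n} (hij : (j : ℕ) = i + 1) (hfg : f i * f j = g i * g j)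
    (h : ∀ k, k ≠ i → k ≠ j → f k = g k) : (List.ofFn f).prod = (List.ofFn g).prod := by
  induction n with
  | zero => exact i.elim0
  | succ n ih =>
    obtain ⟨j, rfl⟩ := Fin.exists_succ_eq.2 (show j ≠ 0 by rintro rfl; simp at hij)
    rw [List.ofFn_succ, List.ofFn_succ, List.prod_cons, List.prod_cons]
    cases i using Fin.cases with
    | zero =>
      cases n with
      | zero => exact j.elim0
      | succ n =>
        obtain rfl : j = 0 := by ext; simpa using hij
        rw [List.ofFn_succ, List.ofFn_succ, List.prod_cons, List.prod_cons, ← mul_assoc, hfg,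
          mul_assoc]
        congr 4
        funext k
        exact h _ (Fin.succ_ne_zero _) fun e => Fin.succ_ne_zero _ (Fin.succ_injective _ e)
    | succ i =>
      rw [h 0 (Fin.succ_ne_zero _).symm (Fin.succ_ne_zero _).symm,
        ih (i := i) (j := j) (f := fun k => f k.succ) (by simpa using hij) hfg
          fun k hi hj => h _ (by simpa using hi) (by simpa using hj)]

variable {A : Type*} [Ring A] {L : Type*} [Ring L] [Algebra ℂ L]

theorem powMap_tprod {M : Type*} [AddCommGroup M] [Module ℂ M] (φ : M →ₗ[ℂ] L) {n : ℕ}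
    (m : Fin n → M) :
    powMap φ n (PiTensorProduct.tprod ℂ m) = (List.ofFn fun i => φ (m i)).prod := by
  simp [powMap]

theorem balancedPowRel_le_ker_powMap {M : Type*} [AddCommGroup M] [Module ℂ M] [Module A M]
    [Module Aᵐᵒᵖ M] {θ : A → L} {φ : M →ₗ[ℂ] L} (hl : ∀ a m, φ (a • m) = θ a * φ m)
    (hr : ∀ (a : A) m, φ (m <• a) = φ m * θ a) (n : ℕ) :
    balancedPowRel A M n ≤ LinearMap.ker (powMap φ n) := by
  refine Submodule.span_le.2 ?_
  rintro _ ⟨m, i, j, a, hij, rfl⟩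
  have hne : i ≠ j := by rintro rfl; omega
  rw [SetLike.mem_coe, LinearMap.mem_ker, map_sub, sub_eq_zero, powMap_tprod, powMap_tprod]
  refine List.prod_ofFn_eq_of_adjacent hij ?_ fun k hi hj => ?_
  · simp [hne, hne.symm, hl, hr, mul_assoc]
  · simp [hi, hj]

namespace Twist

variable [Algebra ℂ A] (α : A ≃ₐ[ℂ] A)

/-- The linear map `a ↦ a ⊗ 1 ⊗ ⋯ ⊗ 1` from `A` to the `ℂ`-tensor power of `A_α` with `n + 1`
factors. -/
def headTensor (n : ℕ) : A →ₗ[ℂ] ⨂[ℂ] _ : Fin (n + 1), Twist α :=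
  (PiTensorProduct.tprod ℂ).toLinearMap (fun _ => mk α 1) 0 ∘ₗ (mk α).toLinearMap

theorem headTensor_apply (n : ℕ) (a : A) : headTensor α n a =
    PiTensorProduct.tprod ℂ (Function.update (fun _ : Fin (n + 1) => mk α 1) 0 (mk α a)) := rfl

/-- The factors of an elementary tensor can be moved into the first one, beginning with the last:
`⋯ ⊗ x ⊗ y` and `⋯ ⊗ x <• y ⊗ 1` are identified in the tensor power over `A`. -/
theorem exists_tprod_sub_headTensor_mem (n k : ℕ) (m : Fin (n + 1) → Twist α)
    (hm : ∀ i : Fin (n + 1), k < (i : ℕ) → m i = mk α 1) :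
    ∃ a, PiTensorProduct.tprod ℂ m - headTensor α n a ∈ balancedPowRel A (Twist α) (n + 1) := by
  induction k generalizing m with
  | zero =>
    refine ⟨(mk α).symm (m 0), ?_⟩
    have : Function.update (fun _ : Fin (n + 1) => mk α 1) 0 (mk α ((mk α).symm (m 0))) = m := by
      funext i
      rcases eq_or_ne i 0 with rfl | hi
      · simp
      · rw [Function.update_of_ne hi, hm i (Nat.pos_of_ne_zero fun h => hi (Fin.ext h))]
    rw [headTensor_apply, this, sub_self]
    exact zero_mem _
  | succ k ih =>
    by_cases hk : k + 1 < n + 1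
    · let i : Fin (n + 1) := ⟨k, by omega⟩
      let j : Fin (n + 1) := ⟨k + 1, hk⟩
      have hij : i ≠ j := by simp [i, j]
      let m' := Function.update m j (mk α 1)
      let a := (mk α).symm (m j)
      obtain ⟨b, hb⟩ := ih (Function.update m' i (m' i <• a)) fun l hl => by
        have hli : l ≠ i := by rintro rfl; exact lt_irrefl _ hl
        rw [Function.update_of_ne hli]
        rcases eq_or_ne l j with rfl | hlj
        · exact Function.update_self ..
        · have : (l : ℕ) ≠ k + 1 := fun e => hlj (Fin.ext e)
          exact (Function.update_of_ne hlj _ _).trans (hm l (by omega))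
      have hrel : PiTensorProduct.tprod ℂ (Function.update m' i (m' i <• a)) -
          PiTensorProduct.tprod ℂ (Function.update m' j (a • m' j)) ∈
          balancedPowRel A (Twist α) (n + 1) := Submodule.subset_span ⟨m', i, j, a, rfl, rfl⟩
      have hmj : Function.update m' j (a • m' j) = m := by
        have : a • m' j = m j := by
          rw [show m' j = mk α 1 from Function.update_self .., smul_mk, mul_one]
          exact (mk α).apply_symm_apply _
        rw [this, Function.update_idem, Function.update_eq_self]
      rw [hmj] at hrel
      refine ⟨b, ?_⟩
      have := sub_mem hb hrel
      rwa [sub_sub_sub_cancel_left] at this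
    · exact ih m fun l hl => by omega

/-- Every element of the tensor power of `A_α` over `A` is of the form `a ⊗ 1 ⊗ ⋯ ⊗ 1`. -/
theorem exists_sub_headTensor_mem (n : ℕ) (z : ⨂[ℂ] _ : Fin (n + 1), Twist α) :
    ∃ a, z - headTensor α n a ∈ balancedPowRel A (Twist α) (n + 1) := by
  induction z using PiTensorProduct.induction_on with
  | smul_tprod c m =>
    obtain ⟨a, ha⟩ := exists_tprod_sub_headTensor_mem α n n m fun i hi => by omega
    exact ⟨c • a, by simpa [smul_sub] using Submodule.smul_mem _ c ha⟩
  | add x y hx hy =>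
    obtain ⟨a, ha⟩ := hx
    obtain ⟨b, hb⟩ := hy
    refine ⟨a + b, ?_⟩
    rw [map_add, add_sub_add_comm]
    exact add_mem ha hb

variable {α}

theorem map_mk {θ : A → L} {φ : Twist α →ₗ[ℂ] L} (hl : ∀ a m, φ (a • m) = θ a * φ m) (a : A) :
    φ (mk α a) = θ a * φ (mk α 1) := by
  rw [← hl, smul_mk, mul_one]

theorem powMap_headTensor {θ : A → L} {φ : Twist α →ₗ[ℂ] L}
    (hl : ∀ a m, φ (a • m) = θ a * φ m) (n : ℕ) (a : A) :
    powMap φ (n + 1) (headTensor α n a) = θ a * φ (mk α 1) ^ (n + 1) := by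
  rw [headTensor_apply, powMap_tprod, List.ofFn_succ, List.prod_cons]
  simp [map_mk hl a, pow_succ', mul_assoc]

theorem range_powMap {θ : A → L} {φ : Twist α →ₗ[ℂ] L} (hl : ∀ a m, φ (a • m) = θ a * φ m)
    (hr : ∀ (a : A) m, φ (m <• a) = φ m * θ a) (n : ℕ) (x : L) :
    x ∈ LinearMap.range (powMap φ (n + 1)) ↔ ∃ a, x = θ a * φ (mk α 1) ^ (n + 1) := by
  constructor
  · rintro ⟨z, rfl⟩
    obtain ⟨a, ha⟩ := exists_sub_headTensor_mem α n z
    have := balancedPowRel_le_ker_powMap hl hr _ ha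
    rw [LinearMap.mem_ker, map_sub, sub_eq_zero] at this
    exact ⟨a, this.trans (powMap_headTensor hl n a)⟩
  · rintro ⟨a, rfl⟩
    exact ⟨_, powMap_headTensor hl n a⟩

/-- The kernel of `A_α^{⊗ (n + 1)} → L` consists of the balancing relations if the
monomials `a φ(1)ⁿ⁺¹` determine their coefficients. -/
theorem ker_powMap {θ : A → L} {φ : Twist α →ₗ[ℂ] L}
    (hl : ∀ a m, φ (a • m) = θ a * φ m) (hr : ∀ (a : A) m, φ (m <• a) = φ m * θ a) (n : ℕ)
    (h : ∀ a, θ a * φ (mk α 1) ^ (n + 1) = 0 → a = 0) :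
    LinearMap.ker (powMap φ (n + 1)) = balancedPowRel A (Twist α) (n + 1) := by
  refine le_antisymm (fun z hz => ?_) (balancedPowRel_le_ker_powMap hl hr _)
  obtain ⟨a, ha⟩ := exists_sub_headTensor_mem α n z
  have := balancedPowRel_le_ker_powMap hl hr _ ha
  rw [LinearMap.mem_ker, map_sub, LinearMap.mem_ker.1 hz, zero_sub, neg_eq_zero,
    powMap_headTensor hl] at this
  rwa [h a this, map_zero, sub_zero] at ha

end Twist

end TensorPower

/-! ### The Laurent tensor algebra of `A_α` -/

namespace CompatibleTriple

variable {A : Type*} [Ring A] [Algebra ℂ A] {α : A ≃ₐ[ℂ] A} {L : Type*} [Ring L] [Algebra ℂ L]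
  (S : CompatibleTriple (Twist.inversePair α) L)

/-- The image of `t` under a compatible triple: the elements `φ(1)` and `ψ(1)` are mutually
inverse. -/
def unit : Lˣ where
  val := S.φ (Twist.mk α 1)
  inv := S.ψ (Twist.mk α.symm 1)
  val_inv := by
    rw [S.φ_mul_ψ]
    change S.θ (Twist.pairing₁ α _ _) = 1
    simp [Twist.pairing₁_mk]
  inv_val := by
    rw [S.ψ_mul_φ]
    change S.θ (Twist.pairing₂ α _ _) = 1
    simp [Twist.pairing₂_mk]

theorem unit_mul (a : A) : S.unit * S.θ a = S.θ (α a) * S.unit := by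
  change S.φ _ * S.θ a = S.θ (α a) * S.φ _
  rw [← S.φ_op_smul, ← S.φ_smul, Twist.mk_smul, Twist.smul_mk, one_mul, mul_one]

theorem φ_mk (x : A) : S.φ (Twist.mk α x) = S.θ x * S.unit := Twist.map_mk S.φ_smul x

theorem ψ_mk (x : A) : S.ψ (Twist.mk α.symm x) = S.θ x * ↑S.unit⁻¹ := Twist.map_mk S.ψ_smul x

/-- The canonical homomorphism from the Laurent Ore extension to the target of a compatible
triple. -/
def ofLaurentOre : LaurentOre α →ₐ[ℂ] L := LaurentOre.lift S.θ S.unit S.unit_mul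

theorem ofLaurentOre_monomial (n : ℤ) (a : A) :
    S.ofLaurentOre (LaurentOre.monomial α n a) = S.θ a * ↑(S.unit ^ n) :=
  LaurentOre.lift_monomial ..

theorem mem_component (n : ℤ) (x : L) :
    x ∈ S.component n ↔ ∃ a, x = S.ofLaurentOre (LaurentOre.monomial α n a) := by
  simp only [ofLaurentOre_monomial]
  match n with
  | Int.ofNat 0 => simp [component, eq_comm]
  | Int.ofNat (n + 1) => exact Twist.range_powMap S.φ_smul S.φ_op_smul n x
  | Int.negSucc n =>
    rw [zpow_negSucc, ← inv_pow]
    exact Twist.range_powMap S.ψ_smul S.ψ_op_smul n x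

theorem IsLaurentTensorAlgebra.eq_zero_of_monomial (hS : S.IsLaurentTensorAlgebra) (n : ℤ) (a : A)
    (h : S.ofLaurentOre (LaurentOre.monomial α n a) = 0) : a = 0 := by
  rw [ofLaurentOre_monomial] at h
  simpa using hS.θ_injective ((Units.mul_left_eq_zero _).1 h |>.trans S.θ.map_zero.symm)

theorem isLaurentTensorAlgebra_of_bijective (h : Function.Bijective S.ofLaurentOre) :
    S.IsLaurentTensorAlgebra := by
  have h0 (a : A) (ha : S.θ a = 0) : a = 0 := by
    have : LaurentOre.monomial α 0 a = 0 := h.1 (by simp [ofLaurentOre_monomial, ha])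
    exact SkewMonoidAlgebra.single_eq_zero.1 this
  refine ⟨(injective_iff_map_eq_zero _).2 h0, fun n => ?_, fun n => ?_, ?_⟩
  · exact Twist.ker_powMap S.φ_smul S.φ_op_smul n fun a ha =>
      h0 a ((Units.mul_left_eq_zero (S.unit ^ (n + 1))).1 ha)
  · exact Twist.ker_powMap S.ψ_smul S.ψ_op_smul n fun a ha =>
      h0 a ((Units.mul_left_eq_zero (S.unit⁻¹ ^ (n + 1))).1 ha)
  · refine DirectSum.isInternal_submodule_of_iSupIndep_of_iSup_eq_top ?_ ?_
    · rw [iSupIndep_iff_finsetSum_eq_zero_imp_eq_zero]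
      intro s v hv hs n hn
      choose! a ha using fun n hn => (S.mem_component n (v n)).1 (hv n hn)
      rw [Finset.sum_congr rfl ha, ← map_sum] at hs
      rw [ha n hn, LaurentOre.eq_zero_of_sum_monomial_eq_zero s a (h.1 (hs.trans (map_zero _).symm))
        n hn, map_zero, map_zero]
    · refine eq_top_iff.2 fun x _ => ?_
      obtain ⟨x, rfl⟩ := h.2 x
      rw [LaurentOre.eq_sum_monomial x, map_sum]
      exact sum_mem fun n _ => Submodule.mem_iSup_of_mem _ ((S.mem_component _ _).2 ⟨_, rfl⟩)

theorem IsLaurentTensorAlgebra.bijective (hS : S.IsLaurentTensorAlgebra) :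
    Function.Bijective S.ofLaurentOre := by
  refine ⟨(injective_iff_map_eq_zero _).2 fun x hx => ?_, fun x => ?_⟩
  · rw [LaurentOre.eq_sum_monomial x, map_sum] at hx
    rw [LaurentOre.eq_sum_monomial x]
    refine Finset.sum_eq_zero fun n hn => ?_
    have := (iSupIndep_iff_finsetSum_eq_zero_imp_eq_zero _).1 hS.isInternal.submodule_iSupIndep
      x.support (fun n : ℤ => S.ofLaurentOre (LaurentOre.monomial α n (x.coeff n)))
      (fun n _ => (S.mem_component _ _).2 ⟨_, rfl⟩) hx n hn
    rw [hS.eq_zero_of_monomial S n _ this, map_zero]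
  · have hle : iSup S.component ≤ LinearMap.range S.ofLaurentOre.toLinearMap := by
      refine iSup_le fun n x hx => ?_
      obtain ⟨a, rfl⟩ := (S.mem_component n x).1 hx
      exact ⟨_, rfl⟩
    rw [hS.isInternal.submodule_iSup_eq_top] at hle
    exact hle trivial

end CompatibleTriple

theorem LaurentOre.isLaurentTensorAlgebra_triple {A : Type*} [Ring A] [Algebra ℂ A]
    (α : A ≃ₐ[ℂ] A) : (LaurentOre.triple α).IsLaurentTensorAlgebra := by
  have : (LaurentOre.triple α).ofLaurentOre = AlgHom.id ℂ _ :=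
    LaurentOre.algHom_ext (fun _ => LaurentOre.lift_C ..) (LaurentOre.lift_t ..)
  refine CompatibleTriple.isLaurentTensorAlgebra_of_bijective _ ?_
  rw [this]
  exact Function.bijective_id

/-! ### The analytic Laurent tensor algebra of `A_α` -/

namespace TopCompatibleTriple

variable {A : Type u} [Ring A] [Algebra ℂ A] [UniformSpace A] [IsArensMichaelAlgebra A]
  {α : A ≃A[ℂ] A} {L B : Type u} [Ring L] [Algebra ℂ L] [UniformSpace L] [Ring B] [Algebra ℂ B]
  [UniformSpace B]

section

variable (T : TopCompatibleTriple (Twist.topInversePair α) L)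

/-- The algebraic compatible triple underlying a topological one. -/
def toCompatibleTriple : CompatibleTriple (Twist.inversePair α.toAlgEquiv) L where
  θ := T.θ.toAlgHom
  φ := T.φ.toLinearMap
  ψ := T.ψ.toLinearMap
  φ_smul := T.φ_smul
  φ_op_smul := T.φ_op_smul
  ψ_smul := T.ψ_smul
  ψ_op_smul := T.ψ_op_smul
  φ_mul_ψ := T.φ_mul_ψ
  ψ_mul_φ := T.ψ_mul_φ

/-- The unit `φ(1)`, with inverse `ψ(1)`. -/
def unit : Lˣ := T.toCompatibleTriple.unit

theorem unit_mul (a : A) : T.unit * T.θ a = T.θ (α a) * T.unit := T.toCompatibleTriple.unit_mul a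

theorem φ_mk (x : A) : T.φ (Twist.mk _ x) = T.θ x * T.unit :=
  T.toCompatibleTriple.φ_mk x

theorem ψ_mk (x : A) : T.ψ (Twist.mk _ x) = T.θ x * ↑T.unit⁻¹ :=
  T.toCompatibleTriple.ψ_mk x

end

/-- A continuous homomorphism `θ` and a unit `u` with `u θ(a) = θ(α(a)) u` give the compatible
triple `(θ, x ↦ θ(x) u, y ↦ θ(y) u⁻¹)`. -/
def ofUnit [IsArensMichaelAlgebra B] (θ : A →A[ℂ] B) (u : Bˣ)
    (hu : ∀ a, u * θ a = θ (α a) * u) : TopCompatibleTriple (Twist.topInversePair α) B :=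
  have hu' (a : A) : ↑u⁻¹ * θ a = θ (α.symm a) * ↑u⁻¹ := by
    rw [Units.inv_mul_eq_iff_eq_mul, ← mul_assoc, hu, mul_assoc, Units.mul_inv, mul_one,
      α.apply_symm_apply]
  { θ := θ
    φ := ⟨LinearMap.mulRight ℂ (u : B) ∘ₗ θ.toLinearMap ∘ₗ (Twist.mk _).symm.toLinearMap,
      (θ.cont.mul continuous_const : Continuous fun a : A => θ a * u)⟩
    ψ := ⟨LinearMap.mulRight ℂ (↑u⁻¹ : B) ∘ₗ θ.toLinearMap ∘ₗ (Twist.mk _).symm.toLinearMap,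
      (θ.cont.mul continuous_const : Continuous fun a : A => θ a * ↑u⁻¹)⟩
    φ_smul a m := by
      change θ (a * (Twist.mk _).symm m) * u = θ a * (θ ((Twist.mk _).symm m) * u)
      rw [map_mul, mul_assoc]
    φ_op_smul a m := by
      change θ ((Twist.mk _).symm m * α a) * u = θ ((Twist.mk _).symm m) * u * θ a
      rw [map_mul, mul_assoc, mul_assoc, hu]
    ψ_smul a m := by
      change θ (a * (Twist.mk _).symm m) * ↑u⁻¹ = θ a * (θ ((Twist.mk _).symm m) * ↑u⁻¹)
      rw [map_mul, mul_assoc]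
    ψ_op_smul a m := by
      change θ ((Twist.mk _).symm m * α.symm a) * ↑u⁻¹ = θ ((Twist.mk _).symm m) * ↑u⁻¹ * θ a
      rw [map_mul, mul_assoc, mul_assoc, hu']
    φ_mul_ψ m n := by
      change θ ((Twist.mk _).symm m) * u * (θ ((Twist.mk _).symm n) * ↑u⁻¹) =
        θ ((Twist.mk _).symm m * α ((Twist.mk _).symm n))
      rw [mul_assoc, ← mul_assoc (u : B), hu, mul_assoc, Units.mul_inv, mul_one, map_mul]
    ψ_mul_φ n m := by
      change θ ((Twist.mk _).symm n) * ↑u⁻¹ * (θ ((Twist.mk _).symm m) * u) =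
        θ ((Twist.mk _).symm n * α.symm ((Twist.mk _).symm m))
      rw [mul_assoc, ← mul_assoc (↑u⁻¹ : B), hu', mul_assoc, Units.inv_mul, mul_one, map_mul] }

theorem unit_ofUnit [IsArensMichaelAlgebra B] (θ : A →A[ℂ] B) (u : Bˣ)
    (hu : ∀ a, u * θ a = θ (α a) * u) : (ofUnit θ u hu).unit = u :=
  Units.ext (show θ 1 * (u : B) = u by simp)

/-- A homomorphism of triples is determined by what it does to `θ` and to the unit `φ(1)`. -/
theorem comp_eq_iff [IsArensMichaelAlgebra B] (T : TopCompatibleTriple (Twist.topInversePair α) L)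
    (T' : TopCompatibleTriple (Twist.topInversePair α) B) (k : L →A[ℂ] B) :
    ((∀ a, k (T.θ a) = T'.θ a) ∧ (∀ m, k (T.φ m) = T'.φ m) ∧ ∀ n, k (T.ψ n) = T'.ψ n) ↔
      (∀ a, k (T.θ a) = T'.θ a) ∧ k T.unit = T'.unit := by
  refine ⟨fun h => ⟨h.1, h.2.1 _⟩, fun ⟨h, hu⟩ => ⟨h, fun m => ?_, fun n => ?_⟩⟩
  · obtain ⟨x, rfl⟩ := (Twist.mk _).surjective m
    rw [φ_mk, φ_mk, map_mul, h, hu]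
  · obtain ⟨x, rfl⟩ := (Twist.mk _).surjective n
    have : Units.map (k : L →* B) T.unit = T'.unit := Units.ext hu
    rw [ψ_mk, ψ_mk, map_mul, h, ← this]
    rfl

/-- The universal property of the analytic Laurent tensor algebra in terms of units. -/
theorem isAnalyticLaurentTensorAlgebra_iff [IsArensMichaelAlgebra L]
    (T : TopCompatibleTriple (Twist.topInversePair α) L) :
    T.IsAnalyticLaurentTensorAlgebra ↔
      ∀ (B : Type u) [Ring B] [Algebra ℂ B] [UniformSpace B] [IsArensMichaelAlgebra B]
        (θ : A →A[ℂ] B) (u : Bˣ), (∀ a, u * θ a = θ (α a) * u) →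
        ∃! k : L →A[ℂ] B, (∀ a, k (T.θ a) = θ a) ∧ k T.unit = u := by
  constructor
  · intro h B _ _ _ _ θ u hu
    have := h B (ofUnit θ u hu)
    simp only [comp_eq_iff, unit_ofUnit] at this
    exact this
  · intro h B _ _ _ _ T'
    simp only [comp_eq_iff]
    exact h B T'.θ T'.unit T'.unit_mul

/-- The analytic Laurent tensor algebra is the completion of `A[t, t⁻¹; α]` with respect to all
submultiplicative seminorms which are continuous on `A`. -/
theorem exists_isAnalyticLaurentTensorAlgebra (α : A ≃A[ℂ] A) :
    ∃ (L : Type u) (_ : Ring L) (_ : Algebra ℂ L) (_ : UniformSpace L)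
      (_ : IsArensMichaelAlgebra L) (T : TopCompatibleTriple (Twist.topInversePair α) L),
      T.IsAnalyticLaurentTensorAlgebra := by
  let P : Set (Seminorm ℂ (LaurentOre α.toAlgEquiv)) :=
    {p | (∀ x y, p (x * y) ≤ p x * p y) ∧ Continuous fun a => p (LaurentOre.C _ a)}
  obtain ⟨L, _, _, _, _, ι, hd, hι, hL⟩ := exists_arensMichael_completion (P := P) fun p hp => hp.1
  let θ : A →A[ℂ] L :=
    ⟨ι.comp (LaurentOre.C _), hι (LaurentOre.C _).toLinearMap fun p hp => hp.2⟩
  let u : Lˣ := Units.map (ι : LaurentOre α.toAlgEquiv →* L) (LaurentOre.tUnit _)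
  have hu (a : A) : u * θ a = θ (α a) * u := by
    change ι (LaurentOre.t _) * ι (LaurentOre.C _ a) = ι (LaurentOre.C _ _) * ι (LaurentOre.t _)
    rw [← map_mul, ← map_mul, LaurentOre.t_mul_C]
    rfl
  refine ⟨L, inferInstance, inferInstance, inferInstance, inferInstance, ofUnit θ u hu, ?_⟩
  rw [isAnalyticLaurentTensorAlgebra_iff]
  intro B _ _ _ _ θ' u' hu'
  rw [unit_ofUnit]
  obtain ⟨g, hg⟩ := hL B (LaurentOre.lift θ'.toAlgHom u' hu') fun q hq hm => by
    refine ⟨fun x y => ?_, ?_⟩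
    · simpa using hm _ _
    · have : Continuous fun a => q (θ' a) := hq.comp θ'.cont
      simpa [LaurentOre.lift_C] using this
  refine ⟨g, ⟨fun a => (hg _).trans (LaurentOre.lift_C ..), (hg _).trans (LaurentOre.lift_t ..)⟩,
    fun k hk => ?_⟩
  have hkι : k.toAlgHom.comp ι = LaurentOre.lift θ'.toAlgHom u' hu' :=
    LaurentOre.algHom_ext (fun a => (hk.1 a).trans (LaurentOre.lift_C ..).symm)
      (hk.2.trans (LaurentOre.lift_t ..).symm)
  refine DFunLike.coe_injective (hd.equalizer k.cont g.cont (funext fun x => ?_))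
  exact (DFunLike.congr_fun hkι x).trans (hg x).symm

end TopCompatibleTriple

/-! ### Arens–Michael envelopes of the Laurent Ore extension -/

/-- The conjugate `a ↦ u f(a) u⁻¹` of a continuous homomorphism by a unit. -/
def ContinuousAlgHom.conj {A B : Type*} [Ring A] [Algebra ℂ A] [TopologicalSpace A] [Ring B]
    [Algebra ℂ B] [TopologicalSpace B] [IsTopologicalRing B] (f : A →A[ℂ] B) (u : Bˣ) :
    A →A[ℂ] B where
  toAlgHom := AlgHom.ofLinearMap
    (LinearMap.mulRight ℂ (↑u⁻¹ : B) ∘ₗ LinearMap.mulLeft ℂ (u : B) ∘ₗ f.toLinearMap)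
    (by simp) (by simp [mul_assoc])
  cont := (continuous_const.mul f.cont).mul continuous_const

namespace IsArensMichaelEnvelope

variable {A Ahat : Type u} [Ring A] [Algebra ℂ A] [Ring Ahat] [Algebra ℂ Ahat] [UniformSpace Ahat]
  [IsArensMichaelAlgebra Ahat] {iA : A →ₐ[ℂ] Ahat}

theorem comp_algEquiv (h : IsArensMichaelEnvelope iA) {A' : Type u} [Ring A'] [Algebra ℂ A']
    (e : A' ≃ₐ[ℂ] A) : IsArensMichaelEnvelope (iA.comp e.toAlgHom) := by
  intro B _ _ _ _ f
  have := h B (f.comp e.symm.toAlgHom)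
  simpa [e.surjective.forall] using this

/-- Two Arens–Michael envelopes of an algebra are isomorphic. -/
theorem exists_equiv (h : IsArensMichaelEnvelope iA) {E : Type u} [Ring E] [Algebra ℂ E]
    [UniformSpace E] [IsArensMichaelAlgebra E] {iE : A →ₐ[ℂ] E} (hE : IsArensMichaelEnvelope iE) :
    ∃ e : E ≃A[ℂ] Ahat, ∀ x, e (iE x) = iA x := by
  obtain ⟨f, hf, -⟩ := hE Ahat iA
  obtain ⟨g, hg, -⟩ := h E iE
  have h₁ : g.comp f = ContinuousAlgHom.id ℂ E := hE.hom_ext fun x => by simp [hf, hg]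
  have h₂ : f.comp g = ContinuousAlgHom.id ℂ Ahat := h.hom_ext fun x => by simp [hf, hg]
  exact ⟨{ AlgEquiv.ofAlgHom f.toAlgHom g.toAlgHom
        (AlgHom.ext fun x => congrArg (fun k : Ahat →A[ℂ] Ahat => k x) h₂)
        (AlgHom.ext fun x => congrArg (fun k : E →A[ℂ] E => k x) h₁) with
      continuous_toFun := f.cont
      continuous_invFun := g.cont }, hf⟩

/-- A commutation relation on the image of `A` passes to the envelope: `a ↦ u g(a) u⁻¹` and
`g ∘ α̂` are continuous homomorphisms which agree on the image of `A`. -/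
theorem unit_mul_map (h : IsArensMichaelEnvelope iA) (α : A ≃ₐ[ℂ] A) {B : Type u} [Ring B]
    [Algebra ℂ B] [UniformSpace B] [IsArensMichaelAlgebra B] (g : Ahat →A[ℂ] B) (u : Bˣ)
    (hu : ∀ a, u * g (iA a) = g (iA (α a)) * u) (x : Ahat) :
    u * g x = g (h.mapEquiv α x) * u := by
  let k : Ahat →A[ℂ] Ahat := ⟨(h.mapEquiv α).toAlgEquiv.toAlgHom, (h.mapEquiv α).continuous⟩
  have key : g.conj u = g.comp k := by
    refine (h B ((g.comp k).toAlgHom.comp iA)).unique (fun a => ?_) fun _ => rfl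
    change u * g (iA a) * ↑u⁻¹ = g (h.mapEquiv α (iA a))
    rw [hu, mapEquiv_apply, Units.mul_inv_cancel_right]
  have hx : u * g x * ↑u⁻¹ = g (h.mapEquiv α x) := DFunLike.congr_fun key x
  rw [← hx, Units.inv_mul_cancel_right]

variable (h : IsArensMichaelEnvelope iA) {α : A ≃ₐ[ℂ] A} {L : Type u} [Ring L] [Algebra ℂ L]
  [UniformSpace L] (T : TopCompatibleTriple (Twist.topInversePair (h.mapEquiv α)) L)

/-- The homomorphism `A[t, t⁻¹; α] → L` which is `θ ∘ iA` on `A` and sends `t` to `φ(1)`, for a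
compatible triple over the envelope of `A`. -/
def ofLaurentOre : LaurentOre α →ₐ[ℂ] L :=
  LaurentOre.lift (T.θ.toAlgHom.comp iA) T.unit fun a => by
    have := T.unit_mul (iA a)
    rwa [mapEquiv_apply] at this

theorem ofLaurentOre_monomial (n : ℤ) (a : A) :
    h.ofLaurentOre T (LaurentOre.monomial α n a) = T.θ (iA a) * ↑(T.unit ^ n) :=
  LaurentOre.lift_monomial ..

theorem ofLaurentOre_C (a : A) : h.ofLaurentOre T (LaurentOre.C α a) = T.θ (iA a) :=
  LaurentOre.lift_C ..

theorem ofLaurentOre_t : h.ofLaurentOre T (LaurentOre.t α) = T.unit := LaurentOre.lift_t ..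

theorem ofLaurentOre_tInv : h.ofLaurentOre T (LaurentOre.tInv α) = ↑T.unit⁻¹ :=
  LaurentOre.lift_tInv ..

/-- A homomorphism `f` from `A[t, t⁻¹; α]` to an Arens–Michael algebra is a homomorphism on `A`
together with the unit `f(t)`. The former extends to the envelope of `A`, and the commutation
relation with the latter extends with it. -/
theorem ofLaurentOre_isArensMichaelEnvelope [IsArensMichaelAlgebra L]
    (hT : T.IsAnalyticLaurentTensorAlgebra) : IsArensMichaelEnvelope (h.ofLaurentOre T) := by
  intro B _ _ _ _ f
  let u : Bˣ := Units.map (f : LaurentOre α →* B) (LaurentOre.tUnit α)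
  obtain ⟨θ, hθ, hθu⟩ := h B (f.comp (LaurentOre.C α))
  have hu (a : A) : u * θ (iA a) = θ (iA (α a)) * u := by
    rw [hθ, hθ]
    change f (LaurentOre.t α) * f _ = f _ * f (LaurentOre.t α)
    rw [← map_mul, ← map_mul]
    exact congrArg f (LaurentOre.t_mul_C α a)
  have hk (k : L →A[ℂ] B) : (∀ x, k (h.ofLaurentOre T x) = f x) ↔
      (∀ a, k (T.θ a) = θ a) ∧ k T.unit = u := by
    constructor
    · intro hk
      have hkθ : k.comp T.θ = θ := hθu _ fun a =>
        (congrArg k (h.ofLaurentOre_C T a)).symm.trans (hk _)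
      exact ⟨fun a => DFunLike.congr_fun hkθ a,
        (congrArg k (h.ofLaurentOre_t T)).symm.trans (hk _)⟩
    · rintro ⟨hkθ, hku⟩
      refine DFunLike.congr_fun (LaurentOre.algHom_ext (f := k.toAlgHom.comp (h.ofLaurentOre T))
        (g := f) (fun a => ?_) ?_)
      · exact (congrArg k (h.ofLaurentOre_C T a)).trans ((hkθ _).trans (hθ a))
      · exact (congrArg k (h.ofLaurentOre_t T)).trans hku
  simp only [hk]
  exact T.isAnalyticLaurentTensorAlgebra_iff.1 hT B θ u (h.unit_mul_map α θ u hu)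

end IsArensMichaelEnvelope

end

/-- Let `Ahat` be an Arens–Michael envelope of `A` which is a Fréchet algebra (complete and
metrizable, i.e. first countable), let `α` be an automorphism of `A`, and let `α̂ = h.mapEquiv α` be
the induced automorphism of `Ahat`. Then `A[t, t⁻¹; α]` is the Laurent tensor algebra `L_A(A_α)`,
the analytic Laurent tensor algebra `L` of `Ahat_α̂` over `Ahat` exists, and it is the Arens–Michael
envelope of `A[t, t⁻¹; α]`, hence of `L_A(A_α)`, through the canonical homomorphism. -/
theorem corollary2p1 {A Ahat : Type u} [Ring A] [Algebra ℂ A]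
    [Ring Ahat] [Algebra ℂ Ahat] [UniformSpace Ahat] [IsArensMichaelAlgebra Ahat]
    [FirstCountableTopology Ahat]
    (iA : A →ₐ[ℂ] Ahat) (h : IsArensMichaelEnvelope iA) (α : A ≃ₐ[ℂ] A) :
    (LaurentOre.triple α).IsLaurentTensorAlgebra ∧
    (∃ (L : Type u) (_ : Ring L) (_ : Algebra ℂ L) (_ : UniformSpace L)
      (_ : IsArensMichaelAlgebra L)
      (T : TopCompatibleTriple (Twist.topInversePair (h.mapEquiv α)) L),
      T.IsAnalyticLaurentTensorAlgebra) ∧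
    ∀ (L : Type u) [Ring L] [Algebra ℂ L] [UniformSpace L] [IsArensMichaelAlgebra L]
      (T : TopCompatibleTriple (Twist.topInversePair (h.mapEquiv α)) L),
      T.IsAnalyticLaurentTensorAlgebra →
      (∃ j : LaurentOre α →ₐ[ℂ] L,
        (∀ a : A, j (LaurentOre.C α a) = T.θ (iA a)) ∧
        j (LaurentOre.t α) = T.φ (Twist.mk _ 1) ∧
        j (LaurentOre.tInv α) = T.ψ (Twist.mk _ 1) ∧
        IsArensMichaelEnvelope j ∧
        ∀ (E : Type u) [Ring E] [Algebra ℂ E] [UniformSpace E] [IsArensMichaelAlgebra E]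
          (iE : LaurentOre α →ₐ[ℂ] E), IsArensMichaelEnvelope iE →
          ∃ e : E ≃A[ℂ] L, ∀ x, e (iE x) = j x) ∧
      ∀ (L₀ : Type u) [Ring L₀] [Algebra ℂ L₀]
        (S : CompatibleTriple (Twist.inversePair α) L₀), S.IsLaurentTensorAlgebra →
        ∃ j₀ : L₀ →ₐ[ℂ] L,
          (∀ a : A, j₀ (S.θ a) = T.θ (iA a)) ∧
          (∀ x : A, j₀ (S.φ (Twist.mk α x)) = T.φ (Twist.mk _ (iA x))) ∧
          (∀ y : A, j₀ (S.ψ (Twist.mk α.symm y)) = T.ψ (Twist.mk _ (iA y))) ∧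
          IsArensMichaelEnvelope j₀ := by
  refine ⟨LaurentOre.isLaurentTensorAlgebra_triple α,
    TopCompatibleTriple.exists_isAnalyticLaurentTensorAlgebra _, fun L _ _ _ _ T hT => ?_⟩
  have hj := h.ofLaurentOre_isArensMichaelEnvelope T hT
  refine ⟨⟨h.ofLaurentOre T, h.ofLaurentOre_C T, h.ofLaurentOre_t T, h.ofLaurentOre_tInv T, hj,
    fun E _ _ _ _ iE hE => hj.exists_equiv hE⟩, fun L₀ _ _ S hS => ?_⟩
  -- any other model of the Laurent tensor algebra is isomorphic to the Laurent Ore extension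
  let e : LaurentOre α ≃ₐ[ℂ] L₀ := AlgEquiv.ofBijective S.ofLaurentOre (hS.bijective S)
  have he (n : ℤ) (a : A) :
      h.ofLaurentOre T (e.symm (S.θ a * ↑(S.unit ^ n))) = T.θ (iA a) * ↑(T.unit ^ n) := by
    rw [← S.ofLaurentOre_monomial, ← h.ofLaurentOre_monomial]
    exact congrArg _ (e.symm_apply_apply _)
  refine ⟨(h.ofLaurentOre T).comp e.symm.toAlgHom, fun a => ?_, fun x => ?_, fun y => ?_,
    hj.comp_algEquiv e.symm⟩
  · simpa using he 0 a
  · rw [S.φ_mk, T.φ_mk]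
    simpa using he 1 x
  · rw [S.ψ_mk, T.ψ_mk]
    have := he (-1) y
    rw [zpow_neg_one, zpow_neg_one] at this
    exact this
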